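/- Let $n$ be a natural number and let $\mathcal F^2(\mathbb C^n)$ be the Fock space of all entire functions $f$ on $\mathbb C^n$ with $\|f\|^2=(2\pi)^{-n}\int_{\mathbb C^n}|f(z)|^2e^{-|z|^2/2}\,dv(z)<\infty$, where $dv$ is Lebesgue measure. Let $A$ be a complex $n\times n$ matrix, $B\in\mathbb C^n$ and $\varphi(z)=Az+B$, and suppose that the composition operator $C_\varphi f=f\circ\varphi$ is bounded but not compact on $\mathcal F^2(\mathbb C^n)$. Let $\|C_\varphi\|_e=\inf\{\|C_\varphi-K\|: K \text{ is a compact operator on } \mathcal F^2(\mathbb C^n)\}$ be its essential norm. Then the equation $(I-A^*A)z=A^*B$ has a solution, and for every solution $z_0$ of it $$\|C_\varphi\|_e=\|C_\varphi\|=\exp\Bigl(\tfrac14\langle\varphi(z_0),B\rangle\Bigr),$$ where $\langle z,w\rangle=\sum_{j=1}^n z_j\overline{w_j}$. -/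

import Mathlib

open MeasureTheory
open scoped ComplexConjugate ENNReal

noncomputable section

/-- The Gaussian measure `(2π)⁻ⁿ exp (-|z|² / 2) dv(z)` on `ℂⁿ`, where `dv` is Lebesgue measure. -/
def fockMeasure (n : ℕ) : Measure (EuclideanSpace ℂ (Fin n)) :=
  (volume : Measure (EuclideanSpace ℂ (Fin n))).withDensity
    (fun z => ENNReal.ofReal ((1 / (2 * Real.pi)) ^ n * Real.exp (-(‖z‖ ^ 2) / 2)))

/-- The entire functions on `ℂⁿ` that are square integrable for the Gaussian measure,
as a vector space of functions. -/
def fockSubmodule (n : ℕ) : Submodule ℂ (EuclideanSpace ℂ (Fin n) → ℂ) where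
  carrier := {f | Differentiable ℂ f ∧ MemLp f 2 (fockMeasure n)}
  add_mem' hf hg := ⟨hf.1.add hg.1, hf.2.add hg.2⟩
  zero_mem' := ⟨differentiable_const 0, MemLp.zero⟩
  smul_mem' c _ hf := ⟨hf.1.const_smul c, hf.2.const_smul c⟩

/-- The classical Fock space `F²(ℂⁿ)`.  It is a type synonym, so that it carries the topology of
the `L²` norm defined below and not the topology of pointwise convergence. -/
def FockSpace (n : ℕ) : Type := fockSubmodule n

namespace FockSpace

variable {n : ℕ}

instance : AddCommGroup (FockSpace n) := inferInstanceAs (AddCommGroup (fockSubmodule n))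

instance : Module ℂ (FockSpace n) := inferInstanceAs (Module ℂ (fockSubmodule n))

instance : CoeFun (FockSpace n) (fun _ => EuclideanSpace ℂ (Fin n) → ℂ) :=
  ⟨fun f => f.1⟩

theorem differentiable (f : FockSpace n) : Differentiable ℂ f := f.2.1

theorem memLp (f : FockSpace n) : MemLp f 2 (fockMeasure n) := f.2.2

theorem ext {f g : FockSpace n} (h : ∀ z, f z = g z) : f = g := Subtype.ext (funext h)

theorem volume_absolutelyContinuous (n : ℕ) :
    (volume : Measure (EuclideanSpace ℂ (Fin n))) ≪ fockMeasure n := by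
  refine withDensity_absolutelyContinuous' (by fun_prop) (Filter.Eventually.of_forall fun z => ?_)
  have : 0 < (1 / (2 * Real.pi)) ^ n * Real.exp (-(‖z‖ ^ 2) / 2) := by positivity
  simpa using this

instance : (fockMeasure n).IsOpenPosMeasure :=
  (volume_absolutelyContinuous n).isOpenPosMeasure

/-- The inclusion of the Fock space into `L²` of the Gaussian measure. -/
def toL2 (n : ℕ) : FockSpace n →ₗ[ℂ] Lp ℂ 2 (fockMeasure n) where
  toFun f := f.memLp.toLp f
  map_add' f g := MemLp.toLp_add f.memLp g.memLp
  map_smul' c f := MemLp.toLp_const_smul c f.memLp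

theorem toL2_injective (n : ℕ) : Function.Injective (toL2 n) := by
  intro f g h
  have h' : (f : EuclideanSpace ℂ (Fin n) → ℂ) =ᵐ[fockMeasure n] g :=
    (MemLp.toLp_eq_toLp_iff f.memLp g.memLp).1 h
  have h'' := (f.differentiable.continuous.ae_eq_iff_eq (fockMeasure n)
    g.differentiable.continuous).1 h'
  exact ext fun z => congrFun h'' z

instance : NormedAddCommGroup (FockSpace n) :=
  NormedAddCommGroup.induced (FockSpace n) (Lp ℂ 2 (fockMeasure n)) (toL2 n) (toL2_injective n)

/-- The `L²` inner product; in accordance with Mathlib's convention it is linear in the second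
argument. -/
instance : InnerProductSpace ℂ (FockSpace n) where
  toNormedSpace := NormedSpace.induced ℂ (FockSpace n) (Lp ℂ 2 (fockMeasure n)) (toL2 n)
  inner f g := inner ℂ (toL2 n f) (toL2 n g)
  norm_sq_eq_re_inner f := norm_sq_eq_re_inner (𝕜 := ℂ) (toL2 n f)
  conj_inner_symm f g := inner_conj_symm (toL2 n f) (toL2 n g)
  add_left f g h := by rw [map_add, inner_add_left]
  smul_left f g c := by rw [map_smul, inner_smul_left]

theorem inner_eq_integral (f g : FockSpace n) :
    inner ℂ f g = ∫ z, g z * conj (f z) ∂(fockMeasure n) := by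
  change inner ℂ (toL2 n f) (toL2 n g) = _
  rw [L2.inner_def]
  refine integral_congr_ae ?_
  filter_upwards [f.memLp.coeFn_toLp, g.memLp.coeFn_toLp] with z hf hg
  change inner ℂ (f.memLp.toLp f z) (g.memLp.toLp g z) = _
  rw [hf, hg]
  rfl

theorem norm_sq_eq_integral (f : FockSpace n) :
    ‖f‖ ^ 2 = ∫ z, ‖f z‖ ^ 2 ∂(fockMeasure n) := by
  rw [norm_sq_eq_re_inner (𝕜 := ℂ) f, inner_eq_integral]
  have h : ∀ z, f z * conj (f z) = ((‖f z‖ ^ 2 : ℝ) : ℂ) := fun z => by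
    rw [Complex.mul_conj, Complex.normSq_eq_norm_sq]
  simp_rw [h, integral_complex_ofReal]
  simp

end FockSpace

/-- The bounded operator `T` on the Fock space is the composition operator `C_φ`,
that is, `T f = f ∘ φ` for all `f`. -/
def IsCompositionOperator {n : ℕ} (φ : EuclideanSpace ℂ (Fin n) → EuclideanSpace ℂ (Fin n))
    (T : FockSpace n →L[ℂ] FockSpace n) : Prop :=
  ∀ (f : FockSpace n) (z : EuclideanSpace ℂ (Fin n)), T f z = f (φ z)

/-- The essential norm: the distance in operator norm to the compact operators. -/
def essentialNorm {H : Type*} [NormedAddCommGroup H] [NormedSpace ℂ H] (T : H →L[ℂ] H) : ℝ :=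
  sInf {r : ℝ | ∃ K : H →L[ℂ] H, IsCompactOperator K ∧ r = ‖T - K‖}

/-- The affine map `z ↦ A z + B` of `ℂⁿ`. -/
def affineSymbol {n : ℕ} (A : Matrix (Fin n) (Fin n) ℂ) (B : EuclideanSpace ℂ (Fin n))
    (z : EuclideanSpace ℂ (Fin n)) : EuclideanSpace ℂ (Fin n) :=
  Matrix.toEuclideanLin A z + B

end

open Filter Topology

/-! Write `a` for the linear part, φ z = a z + B, and k_p for the normalized reproducing kernel at
p. The lower bound for ‖C‖ comes from ⟨C k_{φ(w)}, k_w⟩ = exp((‖φ w‖² - ‖w‖²)/4). Boundedness of C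
therefore bounds ‖φ w‖² - ‖w‖² from above, which forces `a` to be a contraction and B to be
orthogonal to `a ζ` whenever ‖a ζ‖ = ‖ζ‖. That orthogonality is the solvability condition for the
equation, which reads a*(φ z₀) = z₀.

At a solution z₀, C is exp((‖φ z₀‖² - ‖z₀‖²)/4) times a product of two isometric Weyl translations
and f ↦ f ∘ a (`apply_affine_eq_weyl`). Composition with a linear contraction is contractive:
complete `a` by a defect operator d to a Gaussian-preserving map (z, w) ↦ a z + d w, and apply the
mean value inequality in w. So the lower bound at z₀ is attained, and the equation turns the
exponent into ⟨φ z₀, B⟩/4.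

If ‖a z‖ < ‖z‖ for all z ≠ 0, then C is compact, by Gaussian domination and weak compactness.
Otherwise some ζ ≠ 0 has ‖a ζ‖ = ‖ζ‖, and z₀ + m ζ solves the equation for every m. The kernels at
these points tend weakly to 0 while the lower bound stays equal to ‖C‖, so no compact perturbation
can lower the norm. -/

/-- The space `ℂⁿ` with its Euclidean norm. -/
abbrev CVec (n : ℕ) : Type := EuclideanSpace ℂ (Fin n)

/-- The Gaussian density of `fockMeasure`. -/
noncomputable def fockDensity (n : ℕ) (z : CVec n) : ℝ :=
  (1 / (2 * Real.pi)) ^ n * Real.exp (-(‖z‖ ^ 2) / 2)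

/-! ### Gaussian measure: characteristic function, invariance, mean value property. -/

section Measure

variable {n : ℕ}

theorem fockDensity_pos (z : CVec n) : 0 < fockDensity n z := by
  unfold fockDensity; positivity

theorem continuous_fockDensity : Continuous (fockDensity n) := by
  unfold fockDensity; fun_prop

theorem fockMeasure_eq_withDensity :
    fockMeasure n = (volume : Measure (CVec n)).withDensity
      (fun z => ENNReal.ofReal (fockDensity n z)) := rfl

theorem integral_fockMeasure {F : Type*} [NormedAddCommGroup F] [NormedSpace ℝ F]
    (f : CVec n → F) :
    ∫ z, f z ∂fockMeasure n = ∫ z, fockDensity n z • f z := by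
  rw [fockMeasure_eq_withDensity, integral_withDensity_eq_integral_toReal_smul
    (continuous_fockDensity.measurable.ennreal_ofReal)
    (Filter.Eventually.of_forall fun _ => ENNReal.ofReal_lt_top)]
  simp only [ENNReal.toReal_ofReal (fockDensity_pos _).le]

theorem lintegral_fockMeasure (f : CVec n → ℝ≥0∞) :
    ∫⁻ z, f z ∂fockMeasure n = ∫⁻ z, ENNReal.ofReal (fockDensity n z) * f z := by
  rw [fockMeasure_eq_withDensity, lintegral_withDensity_eq_lintegral_mul_non_measurable _
    (continuous_fockDensity.measurable.ennreal_ofReal)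
    (Filter.Eventually.of_forall fun _ => ENNReal.ofReal_lt_top)]
  rfl

theorem real_inner_eq_re_inner_complex (x y : CVec n) :
    (inner ℝ x y : ℝ) = (inner ℂ x y : ℂ).re := by
  rw [PiLp.inner_apply, PiLp.inner_apply, Complex.re_sum]
  exact Finset.sum_congr rfl fun i _ => by simp [Complex.inner]

theorem finrank_real_cvec : Module.finrank ℝ (CVec n) = 2 * n := by
  rw [finrank_real_of_complex]; simp

/-- Its value at 0 gives total mass one, and uniqueness of characteristic functions identifies the
linear images of the measure used below. -/
theorem charFun_fockMeasure (t : CVec n) :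
    charFun (fockMeasure n) t = Complex.exp (-(‖t‖ ^ 2 : ℝ) / 2) := by
  rw [charFun_apply, integral_fockMeasure]
  have h := GaussianFourier.integral_cexp_neg_mul_sq_norm_add (V := CVec n)
    (b := (1 / 2 : ℂ)) (by norm_num) Complex.I t
  have e : ∀ z : CVec n, fockDensity n z • Complex.exp ((inner ℝ z t : ℝ) * Complex.I) =
      ((1 / (2 * Real.pi)) ^ n : ℂ) *
        Complex.exp (-(1 / 2 : ℂ) * ‖z‖ ^ 2 + Complex.I * (inner ℝ t z : ℝ)) := fun z => by
    rw [Complex.real_smul, fockDensity, real_inner_comm]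
    push_cast
    rw [mul_assoc, ← Complex.exp_add]
    congr 2; ring
  simp_rw [e]
  rw [integral_const_mul, h, finrank_real_cvec]
  have hp : (Real.pi : ℂ) ≠ 0 := by exact_mod_cast Real.pi_ne_zero
  have e1 : ((2 * n : ℕ) : ℂ) / 2 = (n : ℂ) := by push_cast; field_simp
  rw [e1, Complex.cpow_natCast, ← mul_assoc, ← mul_pow]
  have e2 : (1 / (2 * (Real.pi : ℂ))) * (Real.pi / (1 / 2)) = 1 := by field_simp
  rw [e2, one_pow, one_mul, Complex.I_sq]
  congr 1; push_cast; ring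

instance isProbabilityMeasure_fockMeasure : IsProbabilityMeasure (fockMeasure n) := by
  have h := charFun_fockMeasure (0 : CVec n)
  rw [charFun_zero] at h
  simp only [norm_zero] at h
  have h' : (fockMeasure n).real Set.univ = 1 := by
    have : (((fockMeasure n).real Set.univ : ℝ) : ℂ) = 1 := by rw [h]; simp
    exact_mod_cast this
  refine ⟨?_⟩
  rw [Measure.real, ENNReal.toReal_eq_one_iff] at h'
  exact h'

theorem integrable_exp_neg_mul_norm_sq {b : ℝ} (hb : 0 < b) :
    Integrable (fun z : CVec n => Real.exp (-b * ‖z‖ ^ 2)) := by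
  have := (GaussianFourier.integrable_cexp_neg_mul_sq_norm_add (V := CVec n) (b := (b : ℂ))
    (by simpa using hb) 0 0).norm
  refine this.congr (Filter.Eventually.of_forall fun z => ?_)
  simp [Complex.norm_exp, ← Complex.ofReal_pow]

/-- Squaring gives growth rate 2s, which must stay below the decay rate 1/2 of the density. -/
theorem memLp_exp_mul_norm_sq {s : ℝ} (hs : s < 1 / 4) :
    MemLp (fun z : CVec n => Real.exp (s * ‖z‖ ^ 2)) 2 (fockMeasure n) := by
  have hm : Continuous (fun z : CVec n => Real.exp (s * ‖z‖ ^ 2)) := by fun_prop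
  rw [memLp_two_iff_integrable_sq hm.aestronglyMeasurable, fockMeasure_eq_withDensity,
    integrable_withDensity_iff_integrable_smul₀'
      (continuous_fockDensity.measurable.ennreal_ofReal.aemeasurable)
      (Filter.Eventually.of_forall fun _ => ENNReal.ofReal_lt_top)]
  have := (integrable_exp_neg_mul_norm_sq (n := n) (b := 1 / 2 - 2 * s) (by linarith)).const_mul
    ((1 / (2 * Real.pi)) ^ n)
  refine this.congr (Filter.Eventually.of_forall fun z => ?_)
  simp only [ENNReal.toReal_ofReal (fockDensity_pos z).le, smul_eq_mul]
  rw [fockDensity, mul_assoc, ← Real.exp_nat_mul, ← Real.exp_add]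
  congr 2; push_cast; ring

theorem charFun_map_fockMeasure (a : CVec n →L[ℂ] CVec n) (t : CVec n) :
    charFun ((fockMeasure n).map a) t =
      Complex.exp (-(‖ContinuousLinearMap.adjoint a t‖ ^ 2 : ℝ) / 2) := by
  rw [← charFun_fockMeasure, charFun_apply, charFun_apply,
    integral_map a.continuous.aemeasurable (by fun_prop)]
  simp_rw [real_inner_eq_re_inner_complex, ContinuousLinearMap.adjoint_inner_right]

/-- A linear image of two independent standard Gaussian vectors is standard Gaussian when the
covariances add up to the identity. -/
theorem map_add_prod_fockMeasure (a d : CVec n →L[ℂ] CVec n)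
    (h : ∀ t, ‖ContinuousLinearMap.adjoint a t‖ ^ 2 + ‖ContinuousLinearMap.adjoint d t‖ ^ 2
      = ‖t‖ ^ 2) :
    ((fockMeasure n).prod (fockMeasure n)).map (fun p => a p.1 + d p.2) = fockMeasure n := by
  have hp := Measure.isProbabilityMeasure_map (μ := fockMeasure n) a.continuous.aemeasurable
  have hp' := Measure.isProbabilityMeasure_map (μ := fockMeasure n) d.continuous.aemeasurable
  have e : ((fockMeasure n).prod (fockMeasure n)).map (fun p => a p.1 + d p.2) =
      (fockMeasure n).map a ∗ (fockMeasure n).map d := by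
    rw [Measure.conv, Measure.map_prod_map _ _ a.continuous.measurable d.continuous.measurable,
      Measure.map_map (by fun_prop) (by fun_prop)]
    rfl
  rw [e]
  apply Measure.ext_of_charFun
  ext t
  rw [charFun_conv, charFun_map_fockMeasure, charFun_map_fockMeasure, charFun_fockMeasure,
    ← Complex.exp_add, ← h t]
  congr 1; push_cast; ring

theorem map_unit_smul_fockMeasure {c : ℂ} (hc : ‖c‖ = 1) :
    (fockMeasure n).map (fun z => c • z) = fockMeasure n := by
  have e : (fun z : CVec n => c • z) = ⇑(c • ContinuousLinearMap.id ℂ (CVec n)) := by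
    ext z; simp
  have hp := Measure.isProbabilityMeasure_map (μ := fockMeasure n)
    (c • ContinuousLinearMap.id ℂ (CVec n)).continuous.aemeasurable
  rw [e]
  apply Measure.ext_of_charFun
  ext t
  rw [charFun_map_fockMeasure, charFun_fockMeasure]
  rw [map_smulₛₗ, ContinuousLinearMap.adjoint_id]
  simp [norm_smul, hc]

/-- The mean value property of entire functions for the Gaussian measure. -/
theorem integral_fockMeasure_eq_apply_zero {f : CVec n → ℂ} (hf : Differentiable ℂ f)
    (hi : Integrable f (fockMeasure n)) : ∫ z, f z ∂fockMeasure n = f 0 := by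
  have hc : ∀ θ : ℝ, ‖Complex.exp (θ * Complex.I)‖ = 1 := Complex.norm_exp_ofReal_mul_I
  have hcont : Continuous (fun z : CVec n => f z) := hf.continuous
  have hmp : ∀ θ : ℝ, MeasurePreserving (fun z : CVec n => Complex.exp (θ * Complex.I) • z)
      (fockMeasure n) (fockMeasure n) := fun θ =>
    ⟨by fun_prop, map_unit_smul_fockMeasure (hc θ)⟩
  have h1 : ∀ θ : ℝ, ∫ z, f (Complex.exp (θ * Complex.I) • z) ∂fockMeasure n =
      ∫ z, f z ∂fockMeasure n := fun θ => by
    conv_rhs => rw [← map_unit_smul_fockMeasure (n := n) (hc θ)]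
    rw [integral_map (by fun_prop) hcont.aestronglyMeasurable]
  have h2 : ∀ z : CVec n, ∫ θ in (0 : ℝ)..2 * Real.pi, f (Complex.exp (θ * Complex.I) • z) =
      (2 * Real.pi : ℝ) • f 0 := fun z => by
    have h := DiffContOnCl.circleAverage (f := fun ζ : ℂ => f (ζ • z)) (c := 0) (R := 1)
      (Differentiable.diffContOnCl (by fun_prop))
    simp only [Real.circleAverage_def, circleMap, zero_smul] at h
    rw [← h, smul_smul, mul_inv_cancel₀ (by positivity), one_smul]
    simp
  -- Fubini in (θ, z): averaging over θ first gives f 0 by Cauchy, while averaging over z first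
  -- gives the Gaussian mean by rotation invariance.
  have hprod : Integrable (Function.uncurry fun (θ : ℝ) (z : CVec n) =>
      f (Complex.exp (θ * Complex.I) • z))
      ((volume.restrict (Set.uIoc 0 (2 * Real.pi))).prod (fockMeasure n)) := by
    have hcc : Continuous (Function.uncurry fun (θ : ℝ) (z : CVec n) =>
      f (Complex.exp (θ * Complex.I) • z)) := by
      simp only [Function.uncurry_def]; fun_prop
    rw [integrable_prod_iff hcc.aestronglyMeasurable]
    refine ⟨Filter.Eventually.of_forall fun θ =>
      (hmp θ).integrable_comp_of_integrable hi, ?_⟩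
    have h3 : ∀ θ : ℝ, ∫ z, ‖f (Complex.exp (θ * Complex.I) • z)‖ ∂fockMeasure n =
      ∫ z, ‖f z‖ ∂fockMeasure n := fun θ => by
      conv_rhs => rw [← map_unit_smul_fockMeasure (n := n) (hc θ)]
      rw [integral_map (by fun_prop) hcont.norm.aestronglyMeasurable]
    simp only [Function.uncurry_apply_pair, h3]
    rw [Set.uIoc_of_le (by positivity)]
    exact integrable_const _
  have h4 := intervalIntegral_integral_swap hprod
  simp only [h1, h2, intervalIntegral.integral_const, integral_const, probReal_univ, one_smul,
    sub_zero] at h4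
  exact smul_right_injective ℂ (r := 2 * Real.pi) (by positivity) h4

theorem lintegral_enorm_sq_eq_eLpNorm_sq {α : Type*} [MeasurableSpace α] (μ : Measure α)
    (f : α → ℂ) : ∫⁻ z, ‖f z‖ₑ ^ 2 ∂μ = eLpNorm f 2 μ ^ 2 := by
  have := eLpNorm_nnreal_pow_eq_lintegral (f := f) (μ := μ) (p := 2) two_ne_zero
  simpa using this.symm

/-- The mean value property together with ‖f‖₁ ≤ ‖f‖₂ for a probability measure. Outside L² the
right side is infinite, so the bound applies to slices with no integrability check. -/
theorem enorm_apply_zero_sq_le_lintegral {f : CVec n → ℂ} (hf : Differentiable ℂ f) :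
    ‖f 0‖ₑ ^ 2 ≤ ∫⁻ z, ‖f z‖ₑ ^ 2 ∂fockMeasure n := by
  have hm : AEStronglyMeasurable f (fockMeasure n) := hf.continuous.aestronglyMeasurable
  rw [lintegral_enorm_sq_eq_eLpNorm_sq]
  by_cases h : MemLp f 2 (fockMeasure n)
  · have hi := h.integrable one_le_two
    rw [← integral_fockMeasure_eq_apply_zero hf hi]
    gcongr
    calc _ ≤ ∫⁻ z, ‖f z‖ₑ ∂fockMeasure n := enorm_integral_le_lintegral_enorm _
      _ = eLpNorm f 1 (fockMeasure n) := eLpNorm_one_eq_lintegral_enorm.symm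
      _ ≤ _ := eLpNorm_le_eLpNorm_of_exponent_le one_le_two hm
  · have : eLpNorm f 2 (fockMeasure n) = ⊤ := by
      by_contra hh
      exact h ⟨hm, lt_top_iff_ne_top.2 hh⟩
    simp [this]

end Measure

/-! ### Weyl translations and the reproducing kernel. -/

section Weyl

variable {n : ℕ}

/-- The Weyl translation by `p`, acting on functions on `ℂⁿ`. -/
noncomputable def weyl (p : CVec n) (f : CVec n → ℂ) (z : CVec n) : ℂ :=
  f (z + p) * Complex.exp (-(inner ℂ p z) / 2 - (‖p‖ ^ 2 : ℝ) / 4)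

/-- The normalized reproducing kernel of the Fock space at `p`. -/
noncomputable def fockKernel (p : CVec n) (z : CVec n) : ℂ :=
  Complex.exp (inner ℂ p z / 2 - (‖p‖ ^ 2 : ℝ) / 4)

theorem norm_add_sq_eq (z p : CVec n) :
    ‖z + p‖ ^ 2 = ‖z‖ ^ 2 + 2 * (inner ℂ p z : ℂ).re + ‖p‖ ^ 2 := by
  rw [norm_add_sq (𝕜 := ℂ), ← inner_conj_symm, RCLike.re_eq_complex_re, Complex.conj_re]

theorem fockDensity_add (z p : CVec n) :
    fockDensity n (z + p) =
      fockDensity n z * Real.exp (-(inner ℂ p z : ℂ).re - ‖p‖ ^ 2 / 2) := by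
  rw [fockDensity, fockDensity, mul_assoc, ← Real.exp_add, norm_add_sq_eq]
  congr 2; ring

theorem differentiable_inner_right (p : CVec n) :
    Differentiable ℂ (fun z : CVec n => inner ℂ p z) :=
  (innerSL ℂ p).differentiable

theorem differentiable_weyl (p : CVec n) {f : CVec n → ℂ} (hf : Differentiable ℂ f) :
    Differentiable ℂ (weyl p f) := by
  have := differentiable_inner_right p
  unfold weyl
  fun_prop

theorem differentiable_fockKernel (p : CVec n) : Differentiable ℂ (fockKernel p) := by
  have := differentiable_inner_right p
  unfold fockKernel
  fun_prop

/-- The squared modulus of the exponential factor is exactly the ratio of the densities at z + p and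
z; hence the Weyl translation is isometric. -/
theorem fockDensity_mul_enorm_weyl_sq (p z : CVec n) (f : CVec n → ℂ) :
    ENNReal.ofReal (fockDensity n z) * ‖weyl p f z‖ₑ ^ 2 =
      ENNReal.ofReal (fockDensity n (z + p)) * ‖f (z + p)‖ₑ ^ 2 := by
  simp only [← ofReal_norm, ← ENNReal.ofReal_pow (norm_nonneg _)]
  rw [← ENNReal.ofReal_mul (fockDensity_pos _).le, ← ENNReal.ofReal_mul (fockDensity_pos _).le,
    fockDensity_add, weyl, norm_mul, mul_pow, Complex.norm_exp, ← Real.exp_nat_mul]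
  have : (2 : ℕ) * (-(inner ℂ p z) / 2 - ((‖p‖ ^ 2 : ℝ) : ℂ) / 4).re =
      -(inner ℂ p z : ℂ).re - ‖p‖ ^ 2 / 2 := by
    simp only [Complex.sub_re, Complex.div_ofNat_re, Complex.neg_re, Complex.ofReal_re]
    push_cast; ring
  rw [this]
  congr 1; ring

theorem lintegral_enorm_weyl_sq (p : CVec n) (f : CVec n → ℂ) :
    ∫⁻ z, ‖weyl p f z‖ₑ ^ 2 ∂fockMeasure n = ∫⁻ z, ‖f z‖ₑ ^ 2 ∂fockMeasure n := by
  rw [lintegral_fockMeasure, lintegral_fockMeasure]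
  simp_rw [fockDensity_mul_enorm_weyl_sq]
  exact lintegral_add_right_eq_self
    (fun z => ENNReal.ofReal (fockDensity n z) * ‖f z‖ₑ ^ 2) p

theorem eLpNorm_weyl (p : CVec n) (f : CVec n → ℂ) :
    eLpNorm (weyl p f) 2 (fockMeasure n) = eLpNorm f 2 (fockMeasure n) := by
  have h := lintegral_enorm_weyl_sq p f
  rw [lintegral_enorm_sq_eq_eLpNorm_sq, lintegral_enorm_sq_eq_eLpNorm_sq] at h
  exact (ENNReal.pow_right_strictMono two_ne_zero).injective h

theorem memLp_weyl (p : CVec n) {f : CVec n → ℂ} (hf : Differentiable ℂ f)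
    (h : MemLp f 2 (fockMeasure n)) : MemLp (weyl p f) 2 (fockMeasure n) :=
  ⟨(differentiable_weyl p hf).continuous.aestronglyMeasurable, by
    rw [eLpNorm_weyl]; exact h.2⟩

theorem integral_weyl (p : CVec n) (f : CVec n → ℂ) :
    ∫ z, weyl p f z ∂fockMeasure n = ∫ z, f z * conj (fockKernel p z) ∂fockMeasure n := by
  rw [integral_fockMeasure, integral_fockMeasure,
    ← integral_add_right_eq_self (fun z => fockDensity n z • (f z * conj (fockKernel p z))) p]
  congr 1; ext z
  rw [fockDensity_add, weyl, fockKernel, ← Complex.exp_conj, Complex.real_smul, Complex.real_smul]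
  push_cast
  have : (inner ℂ p z : ℂ).re = (inner ℂ p z + conj (inner ℂ p z : ℂ)) / 2 := by
    rw [Complex.add_conj]; push_cast; ring
  rw [this, mul_left_comm, mul_assoc, mul_left_comm _ (f _), mul_left_comm _ (f _),
    ← Complex.exp_add, inner_add_right, inner_self_eq_norm_sq_to_K]
  congr 3
  simp [Complex.conj_ofNat]
  ring

theorem weyl_neg_one (p : CVec n) : weyl (-p) (fun _ => 1) = fockKernel p := by
  ext z; simp [weyl, fockKernel]

theorem eLpNorm_fockKernel (p : CVec n) : eLpNorm (fockKernel p) 2 (fockMeasure n) = 1 := by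
  rw [← weyl_neg_one, eLpNorm_weyl, eLpNorm_const _ two_ne_zero (NeZero.ne _)]
  simp

theorem memLp_fockKernel (p : CVec n) : MemLp (fockKernel p) 2 (fockMeasure n) :=
  ⟨(differentiable_fockKernel p).continuous.aestronglyMeasurable, by simp [eLpNorm_fockKernel]⟩

/-- The reproducing property of the normalized kernels. -/
theorem integral_mul_conj_fockKernel (p : CVec n) {f : CVec n → ℂ} (hf : Differentiable ℂ f)
    (h : MemLp f 2 (fockMeasure n)) :
    ∫ z, f z * conj (fockKernel p z) ∂fockMeasure n = f p * Real.exp (-‖p‖ ^ 2 / 4) := by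
  rw [← integral_weyl, integral_fockMeasure_eq_apply_zero (differentiable_weyl p hf)
    ((memLp_weyl p hf h).integrable one_le_two)]
  simp [weyl, neg_div]

/-- Integration against the reproducing kernel produces entire functions. -/
theorem differentiable_integral_mul_exp_inner {g : CVec n → ℂ}
    (hg : MemLp g 2 (fockMeasure n)) :
    Differentiable ℂ
      (fun w : CVec n => ∫ z, g z * Complex.exp (inner ℂ z w / 2) ∂fockMeasure n) := by
  intro w₀
  have hgm := hg.1
  set R : ℝ := ‖w₀‖ + 1 with hR
  have hi : Integrable (fun z : CVec n =>
      ‖g z‖ * Real.exp (1 / 8 * ‖z‖ ^ 2)) (fockMeasure n) :=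
    hg.norm.integrable_mul (memLp_exp_mul_norm_sq (by norm_num))
  have hb : ∀ (z w : CVec n), w ∈ Metric.ball w₀ 1 →
      ‖Complex.exp (inner ℂ z w / 2)‖ ≤ Real.exp (R * ‖z‖) := fun z w hw => by
    have hw' : ‖w‖ ≤ R := by
      have := norm_le_norm_add_norm_sub' w w₀
      rw [mem_ball_iff_norm] at hw
      linarith
    have hre : (inner ℂ z w : ℂ).re ≤ ‖z‖ * ‖w‖ :=
      (Complex.re_le_norm _).trans (norm_inner_le_norm z w)
    rw [Complex.norm_exp]
    gcongr
    rw [Complex.div_ofNat_re]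
    nlinarith [norm_nonneg z, norm_nonneg w, mul_le_mul_of_nonneg_left hw' (norm_nonneg z)]
  -- The factor ‖z‖ from differentiating the kernel is absorbed by exp ‖z‖; the constant 2(R + 1)²
  -- completes the square against ‖z‖²/8.
  have he : ∀ z : CVec n, Real.exp (R * ‖z‖) * ‖z‖ ≤
      Real.exp (2 * (R + 1) ^ 2) * Real.exp (1 / 8 * ‖z‖ ^ 2) := fun z => by
    calc Real.exp (R * ‖z‖) * ‖z‖ ≤ Real.exp (R * ‖z‖) * Real.exp ‖z‖ := by
          gcongr; linarith [Real.add_one_le_exp ‖z‖]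
      _ ≤ _ := by
          rw [← Real.exp_add, ← Real.exp_add]
          refine Real.exp_le_exp.2 ?_
          nlinarith [sq_nonneg (‖z‖ - 4 * (R + 1))]
  have he' : ∀ z : CVec n, Real.exp (R * ‖z‖) ≤
      Real.exp (2 * (R + 1) ^ 2) * Real.exp (1 / 8 * ‖z‖ ^ 2) := fun z => by
    rw [← Real.exp_add]
    refine Real.exp_le_exp.2 ?_
    nlinarith [sq_nonneg (‖z‖ - 4 * R), norm_nonneg w₀]
  refine (hasFDerivAt_integral_of_dominated_of_fderiv_le (𝕜 := ℂ)
    (F := fun (w z : CVec n) => g z * Complex.exp (inner ℂ z w / 2))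
    (F' := fun (w z : CVec n) => (g z * (Complex.exp (inner ℂ z w / 2) * (1 / 2))) • innerSL ℂ z)
    (bound := fun z => Real.exp (2 * (R + 1) ^ 2) * (‖g z‖ * Real.exp (1 / 8 * ‖z‖ ^ 2)))
    (Metric.ball_mem_nhds w₀ one_pos) ?_ ?_ ?_ ?_ (hi.const_mul _) ?_).differentiableAt
  · refine Filter.Eventually.of_forall fun w => hgm.mul ?_
    exact Continuous.aestronglyMeasurable (by fun_prop)
  · refine (hi.const_mul (Real.exp (2 * (R + 1) ^ 2))).mono'
      (hgm.mul (Continuous.aestronglyMeasurable (by fun_prop)))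
      (Filter.Eventually.of_forall fun z => ?_)
    rw [norm_mul, mul_left_comm]
    gcongr
    exact (hb z w₀ (Metric.mem_ball_self one_pos)).trans (he' z)
  · refine AEStronglyMeasurable.smul (hgm.mul ?_) ?_
    · exact Continuous.aestronglyMeasurable (by fun_prop)
    · exact (innerSL ℂ (E := CVec n)).continuous.aestronglyMeasurable
  · refine Filter.Eventually.of_forall fun z w hw => ?_
    rw [norm_smul, innerSL_apply_norm, norm_mul, mul_left_comm, mul_assoc]
    refine mul_le_mul_of_nonneg_left (le_trans ?_ (he z)) (norm_nonneg _)
    refine mul_le_mul_of_nonneg_right ?_ (norm_nonneg _)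
    rw [norm_mul]
    calc _ ≤ ‖Complex.exp (inner ℂ z w / 2)‖ * 1 := by gcongr; norm_num
      _ ≤ _ := by rw [mul_one]; exact hb z w hw
  · refine Filter.Eventually.of_forall fun z w _ => ?_
    have h1 : HasFDerivAt (fun w : CVec n => (inner ℂ z w : ℂ)) (innerSL ℂ z) w :=
      (innerSL ℂ z).hasFDerivAt
    have h2 := ((h1.mul_const (1 / 2 : ℂ)).cexp).const_mul (g z)
    simp only [smul_smul] at h2
    simpa only [mul_one_div, mul_assoc] using h2

end Weyl

/-! ### Composition with linear contractions, and the Weyl factorization. -/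

section Contraction

variable {n : ℕ}

/-- A contraction has a defect operator. -/
theorem exists_defect (a : CVec n →L[ℂ] CVec n) (ha : ∀ z, ‖a z‖ ≤ ‖z‖) :
    ∃ d : CVec n →L[ℂ] CVec n, ∀ t,
      ‖ContinuousLinearMap.adjoint a t‖ ^ 2 + ‖ContinuousLinearMap.adjoint d t‖ ^ 2
        = ‖t‖ ^ 2 := by
  have hn : ‖ContinuousLinearMap.adjoint a‖ ≤ 1 := by
    rw [LinearIsometryEquiv.norm_map]
    exact a.opNorm_le_bound zero_le_one fun z => by simpa using ha z
  set S : CVec n →L[ℂ] CVec n := 1 - a * ContinuousLinearMap.adjoint a with hS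
  have hin : ∀ t, inner ℂ (S t) t = ((‖t‖ ^ 2 - ‖ContinuousLinearMap.adjoint a t‖ ^ 2 : ℝ) : ℂ) :=
    fun t => by
      rw [hS, sub_apply, inner_sub_left, one_apply_eq_self,
        mul_apply_eq_comp, ← ContinuousLinearMap.adjoint_inner_right,
        inner_self_eq_norm_sq_to_K, inner_self_eq_norm_sq_to_K]
      push_cast; rfl
  have hpos : 0 ≤ S := by
    rw [ContinuousLinearMap.nonneg_iff_isPositive, ContinuousLinearMap.isPositive_iff_complex]
    intro t
    rw [hin]
    refine ⟨by rw [RCLike.re_to_complex, Complex.ofReal_re], ?_⟩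
    have h1 := (ContinuousLinearMap.adjoint a).le_of_opNorm_le hn t
    rw [one_mul] at h1
    simp only [RCLike.re_to_complex, Complex.ofReal_re]
    nlinarith [norm_nonneg (ContinuousLinearMap.adjoint a t), norm_nonneg t]
  -- The defect operator is the positive square root of 1 - a a*.
  refine ⟨CFC.sqrt S, fun t => ?_⟩
  have hsa : ContinuousLinearMap.adjoint (CFC.sqrt S) = CFC.sqrt S :=
    (IsSelfAdjoint.of_nonneg (CFC.sqrt_nonneg S)).star_eq
  have h2 : inner ℂ (S t) t = ((‖ContinuousLinearMap.adjoint (CFC.sqrt S) t‖ ^ 2 : ℝ) : ℂ) := by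
    conv_lhs => rw [← CFC.sqrt_mul_sqrt_self S hpos]
    rw [mul_apply_eq_comp, ← ContinuousLinearMap.adjoint_inner_right, hsa,
      inner_self_eq_norm_sq_to_K]
    push_cast; rfl
  rw [hin] at h2
  have h3 := Complex.ofReal_injective h2
  linarith

/-- Composition with a linear contraction contracts the norm of the Fock space. -/
theorem lintegral_enorm_comp_sq_le (a : CVec n →L[ℂ] CVec n) (ha : ∀ z, ‖a z‖ ≤ ‖z‖)
    {f : CVec n → ℂ} (hf : Differentiable ℂ f) :
    ∫⁻ z, ‖f (a z)‖ₑ ^ 2 ∂fockMeasure n ≤ ∫⁻ z, ‖f z‖ₑ ^ 2 ∂fockMeasure n := by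
  obtain ⟨d, hd⟩ := exists_defect a ha
  have hc := hf.continuous
  calc ∫⁻ z, ‖f (a z)‖ₑ ^ 2 ∂fockMeasure n
      ≤ ∫⁻ z, ∫⁻ w, ‖f (a z + d w)‖ₑ ^ 2 ∂fockMeasure n ∂fockMeasure n := by
        refine lintegral_mono fun z => ?_
        -- For fixed z, the entire function w ↦ f (a z + d w) takes the value f (a z) at w = 0.
        have := enorm_apply_zero_sq_le_lintegral (f := fun w => f (a z + d w)) (by fun_prop)
        simpa using this
    _ = ∫⁻ p, ‖f (a p.1 + d p.2)‖ₑ ^ 2 ∂(fockMeasure n).prod (fockMeasure n) := by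
        rw [lintegral_prod _ (by fun_prop)]
    _ = ∫⁻ z, ‖f z‖ₑ ^ 2 ∂fockMeasure n := by
        conv_rhs => rw [← map_add_prod_fockMeasure a d hd]
        rw [lintegral_map (by fun_prop) (by fun_prop)]

/-- Factorization of composition with an affine map through Weyl translations. -/
theorem apply_affine_eq_weyl (a : CVec n →L[ℂ] CVec n) (B z₀ : CVec n)
    (h : ContinuousLinearMap.adjoint a (a z₀ + B) = z₀) (f : CVec n → ℂ) (z : CVec n) :
    f (a z + B) = Real.exp ((‖a z₀ + B‖ ^ 2 - ‖z₀‖ ^ 2) / 4) *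
      weyl (-z₀) (fun u => weyl (a z₀ + B) f (a u)) z := by
  have h1 : a (z + -z₀) + (a z₀ + B) = a z + B := by rw [map_add, map_neg]; abel
  -- Here the equation for z₀ enters: it makes the z-linear terms of the two Weyl exponents cancel,
  -- leaving a constant.
  have h2 : inner ℂ (a z₀ + B) (a (z + -z₀)) = inner ℂ z₀ z - (‖z₀‖ ^ 2 : ℝ) := by
    rw [← ContinuousLinearMap.adjoint_inner_left, h, inner_add_right, inner_neg_right,
      inner_self_eq_norm_sq_to_K, sub_eq_add_neg]
    push_cast; rfl
  simp only [weyl]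
  rw [h1, h2, mul_assoc, ← Complex.exp_add, mul_left_comm, Complex.ofReal_exp, ← Complex.exp_add]
  conv_lhs => rw [← mul_one (f (a z + B)), ← Complex.exp_zero]
  congr 2
  rw [inner_neg_left, norm_neg]
  push_cast; ring

end Contraction

/-! ### Norm and essential norm estimates by kernels. -/

namespace FockSpace

variable {n : ℕ}

theorem norm_eq_toReal_eLpNorm (f : FockSpace n) :
    ‖f‖ = (eLpNorm f 2 (fockMeasure n)).toReal :=
  Lp.norm_toLp (f : CVec n → ℂ) f.memLp

/-- The normalized reproducing kernel, as an element of the Fock space. -/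
noncomputable def kernel (p : CVec n) : FockSpace n :=
  ⟨fockKernel p, differentiable_fockKernel p, memLp_fockKernel p⟩

theorem kernel_apply (p z : CVec n) : kernel p z = fockKernel p z := rfl

theorem norm_kernel (p : CVec n) : ‖kernel p‖ = 1 := by
  rw [norm_eq_toReal_eLpNorm]
  change (eLpNorm (fockKernel p) 2 (fockMeasure n)).toReal = 1
  rw [eLpNorm_fockKernel]; rfl

theorem inner_kernel (p : CVec n) (f : FockSpace n) :
    inner ℂ (kernel p) f = f p * Real.exp (-‖p‖ ^ 2 / 4) := by
  rw [inner_eq_integral]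
  exact integral_mul_conj_fockKernel p f.differentiable f.memLp

theorem kernel_apply_self (p : CVec n) : kernel p p = Real.exp (‖p‖ ^ 2 / 4) := by
  rw [kernel_apply, fockKernel, inner_self_eq_norm_sq_to_K, Complex.ofReal_exp]
  congr 1
  simp
  ring

theorem norm_le_of_comp_affine (T : FockSpace n →L[ℂ] FockSpace n) (a : CVec n →L[ℂ] CVec n)
    (B z₀ : CVec n) (hT : ∀ f z, T f z = f (a z + B)) (ha : ∀ z, ‖a z‖ ≤ ‖z‖)
    (h : ContinuousLinearMap.adjoint a (a z₀ + B) = z₀) :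
    ‖T‖ ≤ Real.exp ((‖a z₀ + B‖ ^ 2 - ‖z₀‖ ^ 2) / 4) := by
  set c : ℝ := Real.exp ((‖a z₀ + B‖ ^ 2 - ‖z₀‖ ^ 2) / 4) with hc
  have hc0 : 0 < c := Real.exp_pos _
  refine T.opNorm_le_bound hc0.le fun f => ?_
  have e : (T f : CVec n → ℂ) =
      (c : ℂ) • weyl (-z₀) (fun u => weyl (a z₀ + B) f (a u)) := by
    ext z
    exact (hT f z).trans (apply_affine_eq_weyl a B z₀ h f z)
  have hle : eLpNorm (fun u => weyl (a z₀ + B) f (a u)) 2 (fockMeasure n) ≤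
      eLpNorm f 2 (fockMeasure n) := by
    rw [← eLpNorm_weyl (a z₀ + B) f,
      ← ENNReal.pow_le_pow_left_iff two_ne_zero, ← lintegral_enorm_sq_eq_eLpNorm_sq,
      ← lintegral_enorm_sq_eq_eLpNorm_sq]
    exact lintegral_enorm_comp_sq_le a ha (differentiable_weyl _ f.differentiable)
  rw [norm_eq_toReal_eLpNorm, norm_eq_toReal_eLpNorm, e, eLpNorm_const_smul, eLpNorm_weyl,
    ENNReal.toReal_mul]
  have : ‖(c : ℂ)‖ₑ.toReal = c := by simp [abs_of_pos hc0]
  rw [this]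
  gcongr
  exact f.memLp.2.ne

theorem inner_kernel_comp (T : FockSpace n →L[ℂ] FockSpace n) (φ : CVec n → CVec n)
    (hT : ∀ f z, T f z = f (φ z)) (w : CVec n) :
    inner ℂ (kernel w) (T (kernel (φ w))) =
      (Real.exp ((‖φ w‖ ^ 2 - ‖w‖ ^ 2) / 4) : ℂ) := by
  rw [inner_kernel, hT, kernel_apply_self, ← Complex.ofReal_mul, ← Real.exp_add]
  congr 2; ring

theorem exp_le_norm_of_comp (T : FockSpace n →L[ℂ] FockSpace n) (φ : CVec n → CVec n)
    (hT : ∀ f z, T f z = f (φ z)) (w : CVec n) :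
    Real.exp ((‖φ w‖ ^ 2 - ‖w‖ ^ 2) / 4) ≤ ‖T‖ := by
  have h := norm_inner_le_norm (𝕜 := ℂ) (kernel w) (T (kernel (φ w)))
  rw [inner_kernel_comp T φ hT, norm_kernel, one_mul, Complex.norm_real,
    Real.norm_of_nonneg (Real.exp_pos _).le] at h
  exact h.trans (by simpa [norm_kernel] using T.le_opNorm (kernel (φ w)))

/-- The normalized kernels tend weakly to zero at infinity. -/
theorem tendsto_inner_kernel (f : FockSpace n) :
    Tendsto (fun w : CVec n => inner ℂ (kernel w) f) (comap norm atTop) (𝓝 0) := by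
  rw [Metric.tendsto_nhds]
  intro ε hε
  -- Up to ε/2 in L², f is replaced by a compactly supported g; on that support the kernel at w is
  -- at most exp(|R|‖w‖/2 - ‖w‖²/4).
  obtain ⟨g, hgs, hg, hgc, hgm⟩ := f.memLp.exists_hasCompactSupport_eLpNorm_sub_le
    (by norm_num) (ε := ENNReal.ofReal (ε / 2)) (by simpa using hε)
  obtain ⟨R, hR⟩ := hgs.isCompact.isBounded.exists_norm_le
  obtain ⟨M, hM⟩ := hgs.exists_bound_of_continuous hgc
  have h1 : ∀ w : CVec n, ‖inner ℂ (toL2 n (kernel w)) (hgm.toLp g)‖ ≤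
      M * Real.exp (|R| * ‖w‖ / 2 - ‖w‖ ^ 2 / 4) := fun w => by
    rw [L2.inner_def]
    have hb : ∀ᵐ z ∂fockMeasure n,
        ‖(inner ℂ (toL2 n (kernel w) z) (hgm.toLp g z) : ℂ)‖ ≤
          M * Real.exp (|R| * ‖w‖ / 2 - ‖w‖ ^ 2 / 4) := by
      filter_upwards [(kernel w).memLp.coeFn_toLp, hgm.coeFn_toLp] with z hz hz'
      change ‖(inner ℂ ((kernel w).memLp.toLp _ z) _ : ℂ)‖ ≤ _
      rw [hz, hz']
      have hM0 : 0 ≤ M := (norm_nonneg _).trans (hM z)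
      by_cases hzs : z ∈ tsupport g
      · refine (norm_inner_le_norm _ _).trans ?_
        rw [mul_comm]
        refine mul_le_mul (hM z) ?_ (norm_nonneg _) hM0
        rw [kernel_apply, fockKernel, Complex.norm_exp]
        refine Real.exp_le_exp.2 ?_
        have hre : (inner ℂ w z : ℂ).re ≤ ‖w‖ * ‖z‖ :=
          (Complex.re_le_norm _).trans (norm_inner_le_norm w z)
        have hz2 : ‖w‖ * ‖z‖ ≤ ‖w‖ * |R| :=
          mul_le_mul_of_nonneg_left ((hR z hzs).trans (le_abs_self R)) (norm_nonneg w)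
        simp only [Complex.sub_re, Complex.div_ofNat_re, Complex.ofReal_re]
        linarith
      · rw [image_eq_zero_of_notMem_tsupport hzs, inner_zero_right, norm_zero]
        positivity
    refine (norm_integral_le_of_norm_le_const hb).trans ?_
    simp
  have h2 : Tendsto (fun w : CVec n => M * Real.exp (|R| * ‖w‖ / 2 - ‖w‖ ^ 2 / 4))
      (comap norm atTop) (𝓝 0) := by
    have : Tendsto (fun x : ℝ => M * Real.exp (|R| * x / 2 - x ^ 2 / 4)) atTop (𝓝 0) := by
      rw [← mul_zero M]
      refine (Real.tendsto_exp_atBot.comp ?_).const_mul M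
      have e : (fun x : ℝ => |R| * x / 2 - x ^ 2 / 4) = fun x => x * (|R| / 2 - x / 4) := by
        ext x; ring
      rw [e]
      refine tendsto_id.atTop_mul_atBot₀ ?_
      refine tendsto_atBot_add_const_left _ _ ?_
      exact tendsto_neg_atTop_atBot.comp (tendsto_id.atTop_div_const (by norm_num))
    exact this.comp tendsto_comap
  filter_upwards [h2.eventually (gt_mem_nhds (half_pos hε))] with w hw
  rw [dist_zero_right]
  have h3 : inner ℂ (kernel w) f = inner ℂ (toL2 n (kernel w)) (toL2 n f - hgm.toLp g) +
      inner ℂ (toL2 n (kernel w)) (hgm.toLp g) := by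
    rw [← inner_add_right, sub_add_cancel]; rfl
  have h4 : ‖toL2 n f - hgm.toLp g‖ ≤ ε / 2 := by
    change ‖f.memLp.toLp _ - hgm.toLp g‖ ≤ _
    rw [← MemLp.toLp_sub, Lp.norm_toLp]
    exact ENNReal.toReal_le_of_le_ofReal (by positivity) hg
  have h5 : ‖toL2 n (kernel w)‖ = 1 := norm_kernel w
  calc _ ≤ ‖inner ℂ (toL2 n (kernel w)) (toL2 n f - hgm.toLp g)‖ +
        ‖inner ℂ (toL2 n (kernel w)) (hgm.toLp g)‖ := by rw [h3]; exact norm_add_le _ _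
    _ < ε / 2 + ε / 2 := by
      refine add_lt_add_of_le_of_lt ?_ ((h1 w).trans_lt hw)
      refine (norm_inner_le_norm _ _).trans ?_
      rw [h5, one_mul]; exact h4
    _ = ε := by ring

/-- Along a subsequence K k_{φ(w)} converges in norm to some h, and k_w tends weakly to 0, so K
contributes nothing to the pairing with k_w in the limit. -/
theorem exp_le_norm_sub_of_isCompactOperator (T K : FockSpace n →L[ℂ] FockSpace n)
    (φ : CVec n → CVec n) (hT : ∀ f z, T f z = f (φ z)) (hK : IsCompactOperator K)
    (w : ℕ → CVec n) (hw : Tendsto (fun m => ‖w m‖) atTop atTop) (s : ℝ)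
    (hs : ∀ m, (‖φ (w m)‖ ^ 2 - ‖w m‖ ^ 2) / 4 = s) :
    Real.exp s ≤ ‖T - K‖ := by
  obtain ⟨S, hS, hKS⟩ := hK.image_closedBall_subset_compact
    (f := (K : FockSpace n →ₗ[ℂ] FockSpace n)) 1
  have hmem : ∀ m, K (kernel (φ (w m))) ∈ S := fun m =>
    hKS ⟨kernel (φ (w m)), by simp [norm_kernel], rfl⟩
  obtain ⟨h, -, u, hu, hlim⟩ := hS.tendsto_subseq hmem
  have hw' : Tendsto (fun m => w (u m)) atTop (comap norm atTop) :=
    tendsto_comap_iff.2 (hw.comp hu.tendsto_atTop)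
  have h1 := ((tendsto_inner_kernel h).comp hw').norm
  have h2 := (tendsto_iff_norm_sub_tendsto_zero.1 hlim)
  have h3 := (h2.add h1).const_add ‖T - K‖
  simp only [norm_zero, add_zero] at h3
  refine ge_of_tendsto' h3 fun m => ?_
  have e : (Real.exp s : ℂ) = inner ℂ (kernel (w (u m))) ((T - K) (kernel (φ (w (u m))))) +
      (inner ℂ (kernel (w (u m))) (K (kernel (φ (w (u m)))) - h) +
        inner ℂ (kernel (w (u m))) h) := by
    rw [← inner_add_right, ← inner_add_right, sub_add_cancel, sub_apply,
      sub_add_cancel, inner_kernel_comp T φ hT, hs]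
  calc Real.exp s = ‖(Real.exp s : ℂ)‖ := by
        rw [Complex.norm_real, Real.norm_of_nonneg (Real.exp_pos _).le]
    _ ≤ _ := by
      rw [e]
      refine (norm_add_le _ _).trans (add_le_add ?_ ((norm_add_le _ _).trans
        (add_le_add ?_ le_rfl)))
      · refine (norm_inner_le_norm _ _).trans ?_
        rw [norm_kernel, one_mul]
        simpa [norm_kernel] using (T - K).le_opNorm (kernel (φ (w (u m))))
      · refine (norm_inner_le_norm _ _).trans ?_
        rw [norm_kernel, one_mul]; rfl

end FockSpace

/-! ### Compactness for strictly contracting symbols. -/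

namespace FockSpace

variable {n : ℕ}

/-- The orthogonal projection of `g ∈ L²` to the Fock space, given by the reproducing kernel. -/
noncomputable def projFun (g : Lp ℂ 2 (fockMeasure n)) (w : CVec n) : ℂ :=
  ∫ z, g z * Complex.exp (inner ℂ z w / 2) ∂fockMeasure n

theorem differentiable_projFun (g : Lp ℂ 2 (fockMeasure n)) : Differentiable ℂ (projFun g) :=
  differentiable_integral_mul_exp_inner (Lp.memLp g)

theorem projFun_eq_inner (g : Lp ℂ 2 (fockMeasure n)) (w : CVec n) :
    projFun g w = Real.exp (‖w‖ ^ 2 / 4) * inner ℂ (toL2 n (kernel w)) g := by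
  rw [L2.inner_def, ← integral_const_mul]
  refine integral_congr_ae ?_
  filter_upwards [(kernel w).memLp.coeFn_toLp] with z hz
  change _ = _ * inner ℂ ((kernel w).memLp.toLp _ z) (g z)
  rw [hz, kernel_apply, fockKernel, RCLike.inner_apply, ← Complex.exp_conj, mul_left_comm,
    Complex.ofReal_exp, ← Complex.exp_add]
  congr 2
  simp [Complex.conj_ofNat]

theorem projFun_toL2 (f : FockSpace n) (w : CVec n) : projFun (toL2 n f) w = f w := by
  have h : inner ℂ (toL2 n (kernel w)) (toL2 n f) = f w * Real.exp (-‖w‖ ^ 2 / 4) :=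
    inner_kernel w f
  rw [projFun_eq_inner, h, mul_left_comm, ← Complex.ofReal_mul, ← Real.exp_add]
  have : ‖w‖ ^ 2 / 4 + -‖w‖ ^ 2 / 4 = 0 := by ring
  rw [this]; simp

theorem norm_projFun_le (g : Lp ℂ 2 (fockMeasure n)) (w : CVec n) :
    ‖projFun g w‖ ≤ Real.exp (‖w‖ ^ 2 / 4) * ‖g‖ := by
  rw [projFun_eq_inner, norm_mul, Complex.norm_real, Real.norm_of_nonneg (Real.exp_pos _).le]
  gcongr
  refine (norm_inner_le_norm _ _).trans ?_
  have : ‖toL2 n (kernel w)‖ = 1 := norm_kernel w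
  rw [this, one_mul]

/-- Bounded sequences in a separable Hilbert space have weakly convergent subsequences. -/
theorem exists_weakly_convergent_subseq {H : Type*} [NormedAddCommGroup H]
    [InnerProductSpace ℂ H] [CompleteSpace H] [TopologicalSpace.SeparableSpace H]
    (g : ℕ → H) (hg : ∀ k, ‖g k‖ ≤ 1) :
    ∃ h : H, ‖h‖ ≤ 1 ∧ ∃ u : ℕ → ℕ, StrictMono u ∧
      ∀ x, Tendsto (fun k => inner ℂ x (g (u k))) atTop (𝓝 (inner ℂ x h)) := by
  obtain ⟨l, hl, u, hu, hlim⟩ := WeakDual.isSeqCompact_closedBall ℂ H 0 1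
    (x := fun k => StrongDual.toWeakDual (InnerProductSpace.toDual ℂ H (g k))) (fun k => by
      simpa using hg k)
  refine ⟨(InnerProductSpace.toDual ℂ H).symm (WeakDual.toStrongDual l), by simpa using hl,
    u, hu, fun x => ?_⟩
  have h1 : Tendsto (fun k => inner ℂ (g (u k)) x) atTop (𝓝 (l x)) :=
    ((WeakDual.eval_continuous x).tendsto l).comp hlim
  have h2 : l x = inner ℂ ((InnerProductSpace.toDual ℂ H).symm (WeakDual.toStrongDual l)) x :=
    (InnerProductSpace.toDual_symm_apply).symm
  rw [h2] at h1
  have h3 := (Complex.continuous_conj.tendsto _).comp h1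
  simpa only [Function.comp_def, inner_conj_symm] using h3

/-- Young's inequality with weight δ = 1 - r² gives the coefficient (1 + δ)r² = 1 - δ² < 1. -/
theorem exists_sq_norm_affine_le (a : CVec n →L[ℂ] CVec n) (B : CVec n) {r : ℝ} (hr0 : 0 ≤ r)
    (hr : r < 1) (ha : ∀ z, ‖a z‖ ≤ r * ‖z‖) :
    ∃ s < (1 / 4 : ℝ), ∃ M : ℝ, ∀ z, ‖a z + B‖ ^ 2 / 4 ≤ s * ‖z‖ ^ 2 + M := by
  have hd : 0 < 1 - r ^ 2 := by nlinarith
  refine ⟨(1 - (1 - r ^ 2) ^ 2) / 4, by nlinarith [pow_pos hd 2],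
    (1 + 1 / (1 - r ^ 2)) * ‖B‖ ^ 2 / 4, fun z => ?_⟩
  have h1 : ‖a z + B‖ ≤ r * ‖z‖ + ‖B‖ := (norm_add_le _ _).trans (by gcongr; exact ha z)
  have h2 : ‖a z + B‖ ^ 2 ≤ (r * ‖z‖ + ‖B‖) ^ 2 := by gcongr
  have h3 : 2 * (r * ‖z‖) * ‖B‖ ≤
      (1 - r ^ 2) * (r * ‖z‖) ^ 2 + 1 / (1 - r ^ 2) * ‖B‖ ^ 2 := by
    have h4 : 0 ≤ 1 / (1 - r ^ 2) * ((1 - r ^ 2) * (r * ‖z‖) - ‖B‖) ^ 2 := by positivity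
    have h5 : 1 / (1 - r ^ 2) * ((1 - r ^ 2) * (r * ‖z‖) - ‖B‖) ^ 2 =
        (1 - r ^ 2) * (r * ‖z‖) ^ 2 + 1 / (1 - r ^ 2) * ‖B‖ ^ 2 - 2 * (r * ‖z‖) * ‖B‖ := by
      field_simp; ring
    linarith
  nlinarith

/-- Composition with a strictly contracting affine map is compact. -/
theorem isCompactOperator_of_comp_affine (T : FockSpace n →L[ℂ] FockSpace n)
    (a : CVec n →L[ℂ] CVec n) (B : CVec n) (hT : ∀ f z, T f z = f (a z + B)) {r : ℝ}
    (hr0 : 0 ≤ r) (hr : r < 1) (ha : ∀ z, ‖a z‖ ≤ r * ‖z‖) : IsCompactOperator T := by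
  obtain ⟨s, hs, M, hsM⟩ := exists_sq_norm_affine_le a B hr0 hr ha
  set b : CVec n → ℝ := fun z => Real.exp M * Real.exp (s * ‖z‖ ^ 2) with hb
  have hbL : MemLp b 2 (fockMeasure n) := (memLp_exp_mul_norm_sq hs).const_mul _
  have hbound : ∀ g : Lp ℂ 2 (fockMeasure n), ‖g‖ ≤ 1 → ∀ z, ‖projFun g (a z + B)‖ ≤ b z :=
    fun g hg z => by
      refine (norm_projFun_le g _).trans ?_
      refine (mul_le_of_le_one_right (Real.exp_pos _).le hg).trans ?_
      change _ ≤ Real.exp M * Real.exp (s * ‖z‖ ^ 2)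
      rw [← Real.exp_add]
      exact Real.exp_le_exp.2 (by linarith [hsM z])
  have hdiff : ∀ g : Lp ℂ 2 (fockMeasure n), Differentiable ℂ fun z => projFun g (a z + B) :=
    fun g => (differentiable_projFun g).comp (by fun_prop)
  -- Taking g in the unit ball of L², rather than of the Fock space, gives weak limits without first
  -- proving that the Fock space is complete.
  set S : Set (FockSpace n) := {F | ∃ g : Lp ℂ 2 (fockMeasure n), ‖g‖ ≤ 1 ∧
    ∀ z, F z = projFun g (a z + B)} with hS
  have hScomp : IsCompact S := by
    refine IsSeqCompact.isCompact fun F hF => ?_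
    choose g hg hFg using hF
    have : Fact ((2 : ℝ≥0∞) ≠ ⊤) := ⟨ENNReal.ofNat_ne_top⟩
    have : SecondCountableTopology (Lp ℂ 2 (fockMeasure n)) := Lp.SecondCountableTopology
    obtain ⟨h, hh, u, hu, hlim⟩ := exists_weakly_convergent_subseq g hg
    have hmem : MemLp (fun z => projFun h (a z + B)) 2 (fockMeasure n) :=
      hbL.mono' (hdiff h).continuous.aestronglyMeasurable
        (Eventually.of_forall (hbound h hh))
    set G : FockSpace n := ⟨fun z => projFun h (a z + B), hdiff h, hmem⟩ with hG
    have hGz : ∀ z, G z = projFun h (a z + B) := fun z => rfl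
    refine ⟨G, ⟨h, hh, fun z => rfl⟩, u, hu, ?_⟩
    have hpt : ∀ z, Tendsto (fun k => F (u k) z) atTop (𝓝 (G z)) := fun z => by
      simp only [hFg, hGz, projFun_eq_inner]
      exact (hlim _).const_mul _
    -- Weak convergence gives pointwise convergence, and 2b is a common L² majorant of the
    -- differences.
    have hsq : Tendsto (fun k => ∫ z, ‖(F (u k) - G) z‖ ^ 2 ∂fockMeasure n) atTop (𝓝 0) := by
      have h0 : (0 : ℝ) = ∫ _z : CVec n, (0 : ℝ) ∂fockMeasure n := by simp
      rw [h0]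
      refine tendsto_integral_of_dominated_convergence (fun z => (2 * b z) ^ 2) (fun k => ?_)
        ((hbL.const_mul 2).integrable_sq) (fun k => Eventually.of_forall fun z => ?_)
        (Eventually.of_forall fun z => ?_)
      · exact ((F (u k) - G).differentiable.continuous.norm.pow 2).aestronglyMeasurable
      · rw [Real.norm_of_nonneg (by positivity)]
        have e : (F (u k) - G) z = F (u k) z - G z := rfl
        rw [e, hFg, hGz]
        gcongr
        refine (norm_sub_le _ _).trans ?_
        linarith [hbound (g (u k)) (hg _) z, hbound h hh z]
      · have := (tendsto_iff_norm_sub_tendsto_zero.1 (hpt z)).pow 2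
        rw [zero_pow two_ne_zero] at this
        exact this
    rw [tendsto_iff_norm_sub_tendsto_zero]
    simp only [← norm_sq_eq_integral] at hsq
    have := hsq.sqrt
    simpa [Real.sqrt_sq (norm_nonneg _)] using this
  refine ⟨S, hScomp, mem_of_superset (Metric.closedBall_mem_nhds 0 one_pos) fun f hf => ?_⟩
  refine ⟨toL2 n f, mem_closedBall_zero_iff.1 hf, fun z => ?_⟩
  rw [projFun_toL2, hT]

end FockSpace

/-! ### Linear algebra of the symbol. -/

section Symbol

variable {n : ℕ}

theorem nonpos_of_quadratic_bounded {d e c M : ℝ} (h : ∀ t : ℝ, d * t ^ 2 + e * t + c ≤ M) :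
    d ≤ 0 := by
  by_contra! hd
  -- Adding the inequalities at t and -t removes the linear term; t is chosen so that d t² = |M - c|
  -- + 1.
  have h1 := h (Real.sqrt ((|M - c| + 1) / d))
  have h2 := h (-Real.sqrt ((|M - c| + 1) / d))
  rw [neg_sq] at h2
  rw [Real.sq_sqrt (by positivity), mul_div_cancel₀ _ hd.ne'] at h1 h2
  linarith [le_abs_self (M - c)]

theorem eq_zero_of_linear_bounded {e c M : ℝ} (h : ∀ t : ℝ, e * t + c ≤ M) : e = 0 := by
  by_contra he
  have h1 := h ((M - c + 1) / e)
  rw [mul_div_cancel₀ _ he] at h1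
  linarith

theorem sq_norm_affine_smul (a : CVec n →L[ℂ] CVec n) (B ζ : CVec n) (t : ℝ) :
    ‖a ((t : ℂ) • ζ) + B‖ ^ 2 - ‖(t : ℂ) • ζ‖ ^ 2 =
      (‖a ζ‖ ^ 2 - ‖ζ‖ ^ 2) * t ^ 2 + 2 * (inner ℂ B (a ζ) : ℂ).re * t + ‖B‖ ^ 2 := by
  rw [norm_add_sq_eq, map_smul, inner_smul_right, norm_smul, norm_smul, mul_pow, mul_pow,
    Complex.norm_real, Real.norm_eq_abs, sq_abs, Complex.re_ofReal_mul]
  ring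

theorem contraction_of_bounded (a : CVec n →L[ℂ] CVec n) (B : CVec n) {M : ℝ}
    (h : ∀ w, ‖a w + B‖ ^ 2 - ‖w‖ ^ 2 ≤ M) (z : CVec n) : ‖a z‖ ≤ ‖z‖ := by
  have := nonpos_of_quadratic_bounded fun t : ℝ => by
    have := h ((t : ℂ) • z)
    rwa [sq_norm_affine_smul] at this
  exact le_of_sq_le_sq (by linarith) (norm_nonneg _)

theorem inner_eq_zero_of_bounded (a : CVec n →L[ℂ] CVec n) (B : CVec n) {M : ℝ}
    (h : ∀ w, ‖a w + B‖ ^ 2 - ‖w‖ ^ 2 ≤ M) {ζ : CVec n} (hζ : ‖a ζ‖ = ‖ζ‖) :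
    inner ℂ B (a ζ) = 0 := by
  have key : ∀ ξ : CVec n, ‖a ξ‖ = ‖ξ‖ → (inner ℂ B (a ξ) : ℂ).re = 0 := fun ξ hξ => by
    have := eq_zero_of_linear_bounded (e := 2 * (inner ℂ B (a ξ) : ℂ).re) fun t : ℝ => by
      have := h ((t : ℂ) • ξ)
      rwa [sq_norm_affine_smul, hξ, sub_self, zero_mul, zero_add] at this
    linarith
  refine Complex.ext (key ζ hζ) ?_
  -- Rotating ζ by i turns the vanishing of the real part into that of the imaginary part.
  have := key (Complex.I • ζ) (by rw [map_smul, norm_smul, norm_smul, hζ])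
  rw [map_smul, inner_smul_right] at this
  simpa using this

/-- Fredholm alternative: 1 - a*a is self-adjoint, its kernel consists of vectors whose norm `a`
preserves, and on these ⟨ζ, a*B⟩ = ⟨a ζ, B⟩ = 0. -/
theorem exists_adjoint_affine_eq (a : CVec n →L[ℂ] CVec n) (B : CVec n)
    (h : ∀ ζ, ‖a ζ‖ = ‖ζ‖ → inner ℂ B (a ζ) = 0) :
    ∃ z₀, ContinuousLinearMap.adjoint a (a z₀ + B) = z₀ := by
  set S : CVec n →L[ℂ] CVec n := 1 - ContinuousLinearMap.adjoint a * a with hS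
  have hSa : ContinuousLinearMap.adjoint S = S := by
    rw [← ContinuousLinearMap.star_eq_adjoint, hS, ← ContinuousLinearMap.star_eq_adjoint]
    simp
  have hmem : ContinuousLinearMap.adjoint a B ∈ S.kerᗮ := by
    rw [Submodule.mem_orthogonal]
    intro ζ hζ
    have h1 : ContinuousLinearMap.adjoint a (a ζ) = ζ := by
      have : S ζ = 0 := hζ
      rw [hS, sub_apply, one_apply_eq_self, mul_apply_eq_comp, sub_eq_zero] at this
      exact this.symm
    have h2 : ‖a ζ‖ = ‖ζ‖ := by
      have h3 : inner ℂ (a ζ) (a ζ) = inner ℂ ζ ζ := by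
        rw [← ContinuousLinearMap.adjoint_inner_left, h1]
      rw [inner_self_eq_norm_sq_to_K, inner_self_eq_norm_sq_to_K] at h3
      have h4 : ‖a ζ‖ ^ 2 = ‖ζ‖ ^ 2 := by exact_mod_cast h3
      exact (sq_eq_sq₀ (norm_nonneg _) (norm_nonneg _)).1 h4
    rw [ContinuousLinearMap.adjoint_inner_right, ← inner_conj_symm, h ζ h2, map_zero]
  rw [ContinuousLinearMap.orthogonal_ker, hSa,
    (Submodule.closed_of_finiteDimensional _).submodule_topologicalClosure_eq] at hmem
  obtain ⟨z₀, hz₀⟩ := hmem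
  refine ⟨z₀, ?_⟩
  have h5 : z₀ - ContinuousLinearMap.adjoint a (a z₀) = ContinuousLinearMap.adjoint a B := hz₀
  rw [map_add, ← h5]; abel

theorem adjoint_apply_apply_of_norm_eq (a : CVec n →L[ℂ] CVec n) (ha : ∀ z, ‖a z‖ ≤ ‖z‖)
    {ζ : CVec n} (hζ : ‖a ζ‖ = ‖ζ‖) : ContinuousLinearMap.adjoint a (a ζ) = ζ := by
  have hn : ‖ContinuousLinearMap.adjoint a‖ ≤ 1 := by
    rw [LinearIsometryEquiv.norm_map]
    exact a.opNorm_le_bound zero_le_one fun z => by simpa using ha z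
  have h1 := (ContinuousLinearMap.adjoint a).le_of_opNorm_le hn (a ζ)
  rw [one_mul, hζ] at h1
  have h2 := norm_sub_sq (𝕜 := ℂ) (ContinuousLinearMap.adjoint a (a ζ)) ζ
  have h3 : RCLike.re (inner ℂ (ContinuousLinearMap.adjoint a (a ζ)) ζ) = ‖ζ‖ ^ 2 := by
    rw [ContinuousLinearMap.adjoint_inner_left, ← norm_sq_eq_re_inner, hζ]
  rw [h3] at h2
  have h4 : ‖ContinuousLinearMap.adjoint a (a ζ)‖ ^ 2 ≤ ‖ζ‖ ^ 2 := by gcongr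
  rw [← sub_eq_zero, ← norm_eq_zero, ← sq_eq_zero_iff]
  exact le_antisymm (by linarith) (sq_nonneg _)

theorem tendsto_norm_add_natCast_smul (z : CVec n) {ζ : CVec n} (hζ : ζ ≠ 0) :
    Tendsto (fun m : ℕ => ‖z + (m : ℂ) • ζ‖) atTop atTop := by
  have h : Tendsto (fun m : ℕ => -‖z‖ + (m : ℝ) * ‖ζ‖) atTop atTop :=
    tendsto_atTop_add_const_left _ _
      (tendsto_natCast_atTop_atTop.atTop_mul_const (norm_pos_iff.2 hζ))
  refine tendsto_atTop_mono (fun m => ?_) h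
  have h1 := norm_sub_le (z + (m : ℂ) • ζ) z
  rw [add_sub_cancel_left, norm_smul, Complex.norm_natCast] at h1
  linarith

theorem exists_strict_contraction (a : CVec n →L[ℂ] CVec n) (ha : ∀ z, ‖a z‖ ≤ ‖z‖)
    (h : ∀ ζ, ‖a ζ‖ = ‖ζ‖ → ζ = 0) : ∃ r : ℝ, 0 ≤ r ∧ r < 1 ∧ ∀ z, ‖a z‖ ≤ r * ‖z‖ := by
  -- The sphere is empty exactly when n = 0; otherwise r is the maximum of ‖a z‖ on it.
  rcases (Metric.sphere (0 : CVec n) 1).eq_empty_or_nonempty with he | hne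
  · refine ⟨0, le_rfl, one_pos, fun z => ?_⟩
    have hz : z = 0 := by
      by_contra hz
      have : ((‖z‖⁻¹ : ℝ) : ℂ) • z ∈ Metric.sphere (0 : CVec n) 1 := by
        simp [norm_smul, hz]
      rw [he] at this
      exact this
    simp [hz]
  · obtain ⟨x, hx, hmax⟩ := (isCompact_sphere (0 : CVec n) 1).exists_isMaxOn hne
      (f := fun z => ‖a z‖) (by fun_prop)
    have hx1 : ‖x‖ = 1 := by simpa using hx
    refine ⟨‖a x‖, norm_nonneg _, ?_, fun z => ?_⟩
    · refine lt_of_le_of_ne (hx1 ▸ ha x) fun he => ?_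
      have := h x (by rw [he, hx1])
      rw [this, norm_zero] at hx1
      exact zero_ne_one hx1
    · by_cases hz : z = 0
      · simp [hz]
      have hz' : 0 < ‖z‖ := norm_pos_iff.2 hz
      have h1 : ((‖z‖⁻¹ : ℝ) : ℂ) • z ∈ Metric.sphere (0 : CVec n) 1 := by
        simp [norm_smul, hz]
      have h2 : ‖a (((‖z‖⁻¹ : ℝ) : ℂ) • z)‖ ≤ ‖a x‖ := hmax h1
      rw [map_smul, norm_smul, Complex.norm_real, Real.norm_of_nonneg (by positivity),
        inv_mul_le_iff₀ hz', mul_comm] at h2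
      exact h2

theorem sq_norm_affine_sub_sq_norm (a : CVec n →L[ℂ] CVec n) (B z₀ : CVec n)
    (h : ContinuousLinearMap.adjoint a (a z₀ + B) = z₀) :
    ((‖a z₀ + B‖ ^ 2 - ‖z₀‖ ^ 2 : ℝ) : ℂ) = inner ℂ B (a z₀ + B) := by
  have h1 : inner ℂ (a z₀) (a z₀ + B) = ((‖z₀‖ ^ 2 : ℝ) : ℂ) := by
    rw [← ContinuousLinearMap.adjoint_inner_right, h, inner_self_eq_norm_sq_to_K]
    push_cast; rfl
  have h2 : inner ℂ (a z₀ + B) (a z₀ + B) = ((‖a z₀ + B‖ ^ 2 : ℝ) : ℂ) := by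
    rw [inner_self_eq_norm_sq_to_K]; push_cast; rfl
  rw [Complex.ofReal_sub, ← h1, ← h2, inner_add_left, add_sub_cancel_left]

end Symbol

/-! ### The main theorem. -/

/-- Mathlib's inner product is linear in its second argument, so `inner ℂ B w` is `⟨w, B⟩` in the
convention `⟨w, B⟩ = ∑ j, w j * conj (B j)`. -/
theorem theorem2p1 (n : ℕ) (A : Matrix (Fin n) (Fin n) ℂ) (B : EuclideanSpace ℂ (Fin n))
    (C : FockSpace n →L[ℂ] FockSpace n)
    (hC : IsCompositionOperator (affineSymbol A B) C)
    (hnc : ¬ IsCompactOperator C) :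
    essentialNorm C = ‖C‖ ∧
    (∃ z₀ : EuclideanSpace ℂ (Fin n),
      Matrix.toEuclideanLin (1 - A.conjTranspose * A) z₀ =
        Matrix.toEuclideanLin A.conjTranspose B) ∧
    ∀ z₀ : EuclideanSpace ℂ (Fin n),
      Matrix.toEuclideanLin (1 - A.conjTranspose * A) z₀ =
        Matrix.toEuclideanLin A.conjTranspose B →
      (‖C‖ : ℂ) = Complex.exp ((1 / 4 : ℂ) * inner ℂ B (affineSymbol A B z₀)) := by
  set a : CVec n →L[ℂ] CVec n := LinearMap.toContinuousLinearMap (Matrix.toEuclideanLin A)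
    with ha
  have hT : ∀ f z, C f z = f (a z + B) := fun f z => hC f z
  have hadj : ∀ z, ContinuousLinearMap.adjoint a z = Matrix.toEuclideanLin A.conjTranspose z :=
    fun z => by
      rw [Matrix.toEuclideanLin_conjTranspose_eq_adjoint]; rfl
  have hiff : ∀ z₀ : CVec n, Matrix.toEuclideanLin (1 - A.conjTranspose * A) z₀ =
        Matrix.toEuclideanLin A.conjTranspose B ↔
      ContinuousLinearMap.adjoint a (a z₀ + B) = z₀ := fun z₀ => by
    have e : Matrix.toEuclideanLin (1 - A.conjTranspose * A) z₀ =
        z₀ - ContinuousLinearMap.adjoint a (a z₀) := by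
      rw [hadj, ha, LinearMap.coe_toContinuousLinearMap']
      ext i
      simp [Matrix.toLpLin_apply]
    rw [e, ← hadj, map_add, sub_eq_iff_eq_add, add_comm, eq_comm]
  have hCpos : 0 < ‖C‖ :=
    (Real.exp_pos _).trans_le (FockSpace.exp_le_norm_of_comp C (fun z => a z + B) hT 0)
  have hbdd : ∀ w, ‖a w + B‖ ^ 2 - ‖w‖ ^ 2 ≤ 4 * Real.log ‖C‖ := fun w => by
    have := FockSpace.exp_le_norm_of_comp C (fun z => a z + B) hT w
    rw [← Real.le_log_iff_exp_le hCpos] at this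
    linarith
  have hcontr := contraction_of_bounded a B hbdd
  have horth : ∀ ζ, ‖a ζ‖ = ‖ζ‖ → inner ℂ B (a ζ) = 0 := fun ζ hζ =>
    inner_eq_zero_of_bounded a B hbdd hζ
  have hnorm : ∀ z₀, ContinuousLinearMap.adjoint a (a z₀ + B) = z₀ →
      ‖C‖ = Real.exp ((‖a z₀ + B‖ ^ 2 - ‖z₀‖ ^ 2) / 4) := fun z₀ h =>
    (FockSpace.norm_le_of_comp_affine C a B z₀ hT hcontr h).antisymm
      (FockSpace.exp_le_norm_of_comp C (fun z => a z + B) hT z₀)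
  obtain ⟨z₁, hz₁⟩ := exists_adjoint_affine_eq a B horth
  refine ⟨?_, ⟨z₁, (hiff z₁).2 hz₁⟩, fun z₀ hz₀ => ?_⟩
  · obtain ⟨ζ, hζ, hζ0⟩ : ∃ ζ, ‖a ζ‖ = ‖ζ‖ ∧ ζ ≠ 0 := by
      by_contra! hcon
      obtain ⟨r, hr0, hr1, hr⟩ := exists_strict_contraction a hcontr hcon
      exact hnc (FockSpace.isCompactOperator_of_comp_affine C a B hT hr0 hr1 hr)
    have hlow : ∀ K : FockSpace n →L[ℂ] FockSpace n, IsCompactOperator K → ‖C‖ ≤ ‖C - K‖ := by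
      intro K hK
      have hfix := adjoint_apply_apply_of_norm_eq a hcontr hζ
      -- Since a*a ζ = ζ, the solution set contains the unbounded sequence z₁ + m ζ, on which the
      -- kernel bound always equals ‖C‖.
      have hw : ∀ m : ℕ, ContinuousLinearMap.adjoint a (a (z₁ + (m : ℂ) • ζ) + B) =
          z₁ + (m : ℂ) • ζ := fun m => by
        rw [map_add a, add_right_comm, map_add, hz₁, map_smul, map_smul, hfix]
      have := FockSpace.exp_le_norm_sub_of_isCompactOperator C K (fun z => a z + B) hT hK
        (fun m : ℕ => z₁ + (m : ℂ) • ζ) (tendsto_norm_add_natCast_smul z₁ hζ0)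
        (Real.log ‖C‖) fun m => by rw [hnorm _ (hw m), Real.log_exp]
      rwa [Real.exp_log hCpos] at this
    refine le_antisymm (csInf_le ⟨0, ?_⟩ ⟨0, isCompactOperator_zero, by simp⟩)
      (le_csInf ⟨_, 0, isCompactOperator_zero, rfl⟩ ?_)
    · rintro _ ⟨K, -, rfl⟩
      exact norm_nonneg _
    · rintro _ ⟨K, hK, rfl⟩
      exact hlow K hK
  · have h := (hiff z₀).1 hz₀
    rw [hnorm z₀ h, Complex.ofReal_exp]
    change _ = Complex.exp (1 / 4 * inner ℂ B (a z₀ + B))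
    rw [← sq_norm_affine_sub_sq_norm a B z₀ h]
    congr 1; push_cast; ring
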